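/- **Setting.** Let $N\ge 2$ and let $C\subset\mathbb R^N$ be a compact convex set with nonempty interior whose boundary $\partial C$ is a hypersurface of class $C^2$. Let $\nu$ be its outward unit normal and $S_c$ its shape operator, $D\nu(c)[v]=-S_cv$ for $v\in T_c(\partial C)$. The class $\mathcal O_C$ consists of the open sets $\Omega\subset\mathbb R^N$ such that (1) $\mathrm{int}(C)\subset\Omega$; (2) $\partial\Omega$ is Lipschitz outside $C$; (3) for every $c\in\partial C$ the ray $\{c+t\nu(c):t\ge 0\}$ meets $\Omega$ in a connected set; (4) $C\subset\Omega$ and, for almost every $x\in\partial\Omega$ (surface measure) at which the inward unit normal $n(x)$ exists, the half-line $\{x+tn(x):t\ge0\}$ meets $C$. For $\Omega\in\mathcal O_C$ the thickness function is $d(c)=\sup\{r\ge 0: c+r\nu(c)\in\Omega\}$, $c\in\partial C$; the radial map is $\Phi(c)=c+d(c)\nu(c)$; the reciprocal map sends $x\in\partial\Omega\setminus C$ to $\pi(x)=x+t(x)n(x)$, where $t(x)$ is the smallest $t\ge0$ with $x+tn(x)\in C$; the return map is $F=\pi\circ\Phi:\partial C\to\partial C$. Only domains for which $d$ is finite and of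 class $C^2$ on $\partial C$ and $F$ is defined on all of $\partial C$ are considered. Put $$A_d(c)=2d(c)\bigl(I-d(c)S_c\bigr)^{-1}\quad\text{on } T_c(\partial C),\qquad \mathrm{Crit}(d)=\{c\in\partial C:\nabla_{\partial C}d(c)=0\}.$$ Two thickness functions $d,\tilde d$ are dynamically equivalent if there is a homeomorphism $h$ of $\partial C$ with $h\circ F_d=F_{\tilde d}\circ h$ which maps orbits of $F_d$ onto orbits of $F_{\tilde d}$ preserving their orientation. **Theorem.** Let $\Omega,\tilde\Omega\in\mathcal O_C$ be two such domains, with thickness functions $d,\tilde d$ and with the same return map $F:\partial C\to\partial C$. Assume that both satisfy the same one of the following constraints, where each condition is required of $d$ at the points $c\in\mathrm{Crit}(d)$ and of $\tilde d$ at the points $c\in\mathrm{Crit}(\tilde d)$: 1. (isotropy with known or constant factor) $A_d(c)=\alpha(c)I$ and $A_{\tilde d}(c)=\tilde\alpha(c)I$ with $\alpha,\tilde\alpha>0$, where either $\alpha$ and $\tilde\alpha$ are one and the same given function of $c$ (known factor), or $\alpha$ and $\tilde\alpha$ are two constants, possibly different and unknown (constant factor); 2. (alignment with known spectral weights) $A_d(c)$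 and $\mathrm{Hess}_{\partial C}d(c)$ are simultaneously diagonalizable, and so are $A_{\tilde d}(c)$ and $\mathrm{Hess}_{\partial C}\tilde d(c)$ (possibly in a different basis), and the eigenvalues of $A_d(c)$ and of $A_{\tilde d}(c)$ are the same given numbers $\alpha_1(c),\dots,\alpha_{N-1}(c)$; 3. (known operator) $A_d(c)$ and $A_{\tilde d}(c)$ are equal to one and the same given operator on $T_c(\partial C)$. Then there is a constant $\lambda>0$ with $\tilde d(c)=\lambda\,d(c)$ for all $c\in\partial C$, and $d$ and $\tilde d$ are dynamically equivalent. -/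

import Mathlib

open scoped Topology NNReal RealInnerProductSpace MeasureTheory

noncomputable section

namespace ReturnMap

/-- The ambient Euclidean space of dimension `N`. -/
abbrev E (N : ℕ) : Type := EuclideanSpace ℝ (Fin N)

variable {N : ℕ}

/-! ### The convex core and the geometry of its boundary -/

/-- A compact convex set with nonempty interior whose boundary is a hypersurface of class `C²`:
near each boundary point the set is a sublevel set of a `C²` function with nonzero differential. -/
structure IsConvexCore (C : Set (E N)) : Prop where
  isCompact : IsCompact C
  convex : Convex ℝ C
  nonempty_interior : (interior C).Nonempty
  c2_boundary : ∀ c ∈ frontier C, ∃ g : E N → ℝ,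
    ContDiffAt ℝ 2 g c ∧ fderiv ℝ g c ≠ 0 ∧ ∀ᶠ x in 𝓝 c, (x ∈ C ↔ g x ≤ 0)

/-- `n` is an outward unit normal to the convex set `C` at `c`. -/
def IsOutwardUnitNormal (C : Set (E N)) (c n : E N) : Prop :=
  ‖n‖ = 1 ∧ ∀ y ∈ C, ⟪n, y - c⟫ ≤ 0

/-- The outward unit normal `ν(c)`; at the boundary points of a convex core there is exactly one. -/
def normal (C : Set (E N)) (c : E N) : E N :=
  Classical.epsilon (IsOutwardUnitNormal C c)

/-- The tangent space of `∂C` at `c`, the orthogonal complement of `ν(c)`. -/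
abbrev tangentSpace (C : Set (E N)) (c : E N) : Submodule ℝ (E N) :=
  (ℝ ∙ normal C c)ᗮ

/-- The tangential differential at `c` of a map defined on `∂C`: the restriction to the tangent
space of a differential along `∂C` (all such differentials agree on tangent vectors). -/
def tangentialDeriv {G : Type*} [NormedAddCommGroup G] [NormedSpace ℝ G]
    (C : Set (E N)) (f : E N → G) (c : E N) : tangentSpace C c →L[ℝ] G :=
  (fderivWithin ℝ f (frontier C) c).comp (tangentSpace C c).subtypeL

/-- The shape operator `S_c`, with the sign convention `Dν(c)[v] = -S_c v`. -/
def shapeOperator (C : Set (E N)) (c : E N) : tangentSpace C c →L[ℝ] tangentSpace C c :=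
  -((tangentSpace C c).orthogonalProjectionOnto.comp (tangentialDeriv C (normal C) c))

/-- The Riemannian gradient `∇_{∂C} f (c)`. -/
def tangentialGradient (C : Set (E N)) (f : E N → ℝ) (c : E N) : tangentSpace C c :=
  (InnerProductSpace.toDual ℝ (tangentSpace C c)).symm (tangentialDeriv C f c)

/-- The Riemannian Hessian of `f` at `c` as an operator on the tangent space: the covariant
derivative (tangential part of the differential) of the Riemannian gradient field. -/
def tangentialHessian (C : Set (E N)) (f : E N → ℝ) (c : E N) :
    tangentSpace C c →L[ℝ] tangentSpace C c :=
  (tangentSpace C c).orthogonalProjectionOnto.comp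
    (tangentialDeriv C (fun x => (tangentialGradient C f x : E N)) c)

/-! ### Domains, thickness and return map -/

/-- `n` is the inward unit normal to `Ω` at the boundary point `x`: to first order at `x`, the set
`Ω` is the half-space `⟪n, y - x⟫ > 0`. -/
def IsInwardUnitNormal (Ω : Set (E N)) (x n : E N) : Prop :=
  ‖n‖ = 1 ∧ ∀ ε > 0, ∀ᶠ y in 𝓝 x,
    (ε * ‖y - x‖ < ⟪n, y - x⟫ → y ∈ Ω) ∧ (⟪n, y - x⟫ < -(ε * ‖y - x‖) → y ∉ Ω)

/-- `Ω` is, near `x`, the strict epigraph of a Lipschitz function in some direction `e`. -/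
def IsLipschitzBoundaryAt (Ω : Set (E N)) (x : E N) : Prop :=
  ∃ e : E N, ‖e‖ = 1 ∧ ∃ (K : ℝ≥0) (f : ((ℝ ∙ e)ᗮ : Submodule ℝ (E N)) → ℝ), LipschitzWith K f ∧
    ∀ᶠ y in 𝓝 x, (y ∈ Ω ↔ f ((ℝ ∙ e)ᗮ.orthogonalProjectionOnto y) < ⟪e, y⟫)

/-- The `C`-geometric normal property of an open set containing `C`; "almost every" refers to the
surface measure on `∂Ω`. -/
def GeometricNormalProperty (C Ω : Set (E N)) : Prop :=
  IsOpen Ω ∧ C ⊆ Ω ∧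
    ∀ᵐ x ∂((μH[(N : ℝ) - 1] : MeasureTheory.Measure (E N)).restrict (frontier Ω)),
      ∀ n, IsInwardUnitNormal Ω x n → ∃ t : ℝ, 0 ≤ t ∧ x + t • n ∈ C

/-- The outward normal ray `Δ_c`. -/
def normalRay (C : Set (E N)) (c : E N) : Set (E N) :=
  {x | ∃ t : ℝ, 0 ≤ t ∧ x = c + t • normal C c}

/-- The class `𝒪_C` of admissible domains. -/
structure InClassO (C Ω : Set (E N)) : Prop where
  isOpen : IsOpen Ω
  interior_subset : interior C ⊆ Ω
  lipschitz : ∀ x ∈ frontier Ω \ C, IsLipschitzBoundaryAt Ω x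
  ray_connected : ∀ c ∈ frontier C, IsPreconnected (normalRay C c ∩ Ω)
  normal_property : GeometricNormalProperty C Ω

/-- The radii entering the definition of the thickness at `c`. -/
def radii (C Ω : Set (E N)) (c : E N) : Set ℝ :=
  {r | 0 ≤ r ∧ c + r • normal C c ∈ Ω}

/-- The thickness function `d` of `Ω` (meaningful at the points of `∂C`). -/
def thickness (C Ω : Set (E N)) (c : E N) : ℝ :=
  sSup (radii C Ω c)

/-- The radial map `Φ(c) = c + d(c) ν(c)`. -/
def radialMap (C Ω : Set (E N)) (c : E N) : E N :=
  c + thickness C Ω c • normal C c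

/-- `p = π(x)`: starting at `x ∈ ∂Ω \ C` and moving along the inward unit normal of `Ω`, the point
`p` is the first one that lies in `C`. -/
def IsReciprocal (C Ω : Set (E N)) (x p : E N) : Prop :=
  x ∈ frontier Ω \ C ∧ ∃ n, IsInwardUnitNormal Ω x n ∧
    ∃ t : ℝ, IsLeast {s : ℝ | 0 ≤ s ∧ x + s • n ∈ C} t ∧ p = x + t • n

/-- `F : ∂C → ∂C` is the return map `π ∘ Φ` of `Ω`. -/
def IsReturnMap (C Ω : Set (E N)) (F : frontier C → frontier C) : Prop :=
  ∀ c : frontier C, IsReciprocal C Ω (radialMap C Ω c) (F c)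

/-- `Ω` is a domain of the class `𝒪_C` with (finite) thickness function of class `C²` on `∂C`, and
`F` is its return map. -/
structure IsReturnGeometry (C Ω : Set (E N)) (F : frontier C → frontier C) : Prop where
  inClass : InClassO C Ω
  finite : ∀ c ∈ frontier C, BddAbove (radii C Ω c)
  smooth : ContDiffOn ℝ 2 (thickness C Ω) (frontier C)
  isReturnMap : IsReturnMap C Ω F

/-! ### Dynamical equivalence -/

/-- The forward orbit of `c`. -/
def orbit {X : Type*} (F : X → X) (c : X) : Set X :=
  Set.range fun n : ℕ => F^[n] c

/-- The (thickness functions of the) domains `Ω` and `Ω'` are dynamically equivalent: a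
homeomorphism of `∂C` conjugates their return maps and maps orbits onto orbits, preserving the
order in which the points of an orbit are visited. -/
def DynamicallyEquivalent (C Ω Ω' : Set (E N)) : Prop :=
  ∃ F F' : frontier C → frontier C, IsReturnMap C Ω F ∧ IsReturnMap C Ω' F' ∧
    ∃ h : frontier C ≃ₜ frontier C,
      h ∘ F = F' ∘ h ∧
      (∀ c, h '' orbit F c = orbit F' (h c)) ∧
      ∀ c, ∀ m n : ℕ, m ≤ n →
        ∃ m' n' : ℕ, m' ≤ n' ∧ h (F^[m] c) = F'^[m'] (h c) ∧ h (F^[n] c) = F'^[n'] (h c)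

/-! ### The geometric operator and the three constraints -/

/-- The critical points of the thickness function on `∂C`. -/
def criticalSet (C Ω : Set (E N)) : Set (E N) :=
  {c | c ∈ frontier C ∧ tangentialGradient C (thickness C Ω) c = 0}

/-- The geometric operator `A(c) = 2 d(c) (I - d(c) S_c)⁻¹` on the tangent space.  The operator
`I - d(c) S_c` is invertible at every boundary point, since `-S_c` is positive semidefinite. -/
def geomOperator (C Ω : Set (E N)) (c : E N) : tangentSpace C c →L[ℝ] tangentSpace C c :=
  (2 * thickness C Ω c) •
    Ring.inverse (ContinuousLinearMap.id ℝ (tangentSpace C c) -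
      thickness C Ω c • shapeOperator C c)

/-- The return geometry is isotropic at the critical points, with factor `α`. -/
def IsotropicWith (C Ω : Set (E N)) (α : E N → ℝ) : Prop :=
  ∀ c ∈ criticalSet C Ω, 0 < α c ∧
    geomOperator C Ω c = α c • ContinuousLinearMap.id ℝ (tangentSpace C c)

/-- At the critical points, `A(c)` and the Hessian of the thickness are simultaneously
diagonalizable, and the eigenvalues of `A(c)` are the weights `α c i`. -/
def AlignedWith (C Ω : Set (E N)) (α : E N → Fin (N - 1) → ℝ) : Prop :=
  ∀ c ∈ criticalSet C Ω, ∃ b : Module.Basis (Fin (N - 1)) ℝ (tangentSpace C c), ∀ i,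
    geomOperator C Ω c (b i) = α c i • b i ∧
      ∃ l : ℝ, tangentialHessian C (thickness C Ω) c (b i) = l • b i

/-- At the critical points, the geometric operator is the prescribed one. -/
def HasGeomOperator (C Ω : Set (E N))
    (A : (c : E N) → tangentSpace C c →L[ℝ] tangentSpace C c) : Prop :=
  ∀ c ∈ criticalSet C Ω, geomOperator C Ω c = A c

/-- Two return geometries over the same core satisfy the same one of the geometric constraints:
isotropy with the same known factor or with (possibly different, unknown) constant factors;
alignment with the same known spectral weights; the same known geometric operator. -/
def SameConstraint (C Ω Ω' : Set (E N)) : Prop :=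
  ((∃ α : E N → ℝ, IsotropicWith C Ω α ∧ IsotropicWith C Ω' α) ∨
    ∃ a a' : ℝ, IsotropicWith C Ω (fun _ => a) ∧ IsotropicWith C Ω' (fun _ => a')) ∨
  (∃ α : E N → Fin (N - 1) → ℝ, AlignedWith C Ω α ∧ AlignedWith C Ω' α) ∨
  ∃ A : (c : E N) → tangentSpace C c →L[ℝ] tangentSpace C c,
    HasGeomOperator C Ω A ∧ HasGeomOperator C Ω' A

end ReturnMap

end

open scoped Topology NNReal RealInnerProductSpace MeasureTheory

noncomputable section

namespace ReturnMap

open Filter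

variable {N : ℕ} {C : Set (E N)} {c : E N}

/-! ### The outward normal of a convex core -/

/-! Write z = F(c) - c and q = ⟪ν(c), z⟫, so that q ≤ 0 by convexity. The inward normal n at Φ(c)
annihilates DΦ(v) for every tangent v, and z = dν + tn; eliminating n gives the first order equation
(d - q) ∂_v d = ⟪z, v⟫ - d⟪z, S v⟫ (`IsReturnGeometry.mul_tangentialDeriv`). Its only data besides d
are C and F, so d and d' solve the same equation.

Since S ≤ 0 and d - q > 0, c is critical exactly when the tangential part τ of z vanishes. The two
critical sets therefore coincide, and at their points each constraint fixes 1/d' - 1/d to be one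
constant k (`exists_inv_sub_inv_eq`).

If d and d' agree at one point, the differential of d - d' is bounded by a multiple of |d - d'|, and
Gronwall along Lipschitz paths in ∂C gives d = d' (`thickness_eq_of_eq_at`). Otherwise consider f =
1/d' - 1/d. At an extremum of f, the two equations tested on v = τ force τ = 0
(`displacement_eq_zero_of_isExtrOn`), hence f = k there. So max f = min f, f is constant, every
point is an extremum, and τ vanishes identically. Both thicknesses are then constant, and λ is their
quotient.

Dynamical equivalence is immediate: the return map is shared, and the identity conjugates it to
itself. -/

/-- Hahn-Banach separates c from the interior of C. This is what makes the choice in `normal`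
meaningful. -/
lemma exists_isOutwardUnitNormal (hC : IsConvexCore C) (hc : c ∈ frontier C) :
    ∃ n, IsOutwardUnitNormal C c n := by
  have hdisj : Disjoint (interior C) {c} := by
    rw [Set.disjoint_singleton_right]
    exact hc.2
  obtain ⟨f, u, hf, hfC, hfc⟩ := geometric_hahn_banach_of_nonempty_interior hC.convex
    (convex_singleton c) hdisj hC.nonempty_interior (Set.singleton_nonempty c)
  set a : E N := (InnerProductSpace.toDual ℝ (E N)).symm f with ha
  have hfa : ∀ y, f y = ⟪a, y⟫ := fun y => by
    rw [ha, InnerProductSpace.toDual_symm_apply]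
  have ha0 : a ≠ 0 := by
    rw [ha]
    simpa using hf
  refine ⟨‖a‖⁻¹ • a, norm_smul_inv_norm ha0, fun y hy => ?_⟩
  rw [real_inner_smul_left, inner_sub_right, ← hfa, ← hfa]
  have h1 := hfC y hy
  have h2 := hfc c rfl
  exact mul_nonpos_of_nonneg_of_nonpos (by positivity) (by linarith)

lemma isOutwardUnitNormal_normal (hC : IsConvexCore C) (hc : c ∈ frontier C) :
    IsOutwardUnitNormal C c (normal C c) :=
  Classical.epsilon_spec (exists_isOutwardUnitNormal hC hc)

lemma norm_normal (hC : IsConvexCore C) (hc : c ∈ frontier C) : ‖normal C c‖ = 1 :=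
  (isOutwardUnitNormal_normal hC hc).1

lemma inner_normal_sub_nonpos (hC : IsConvexCore C) (hc : c ∈ frontier C) {y : E N} (hy : y ∈ C) :
    ⟪normal C c, y - c⟫ ≤ 0 :=
  (isOutwardUnitNormal_normal hC hc).2 y hy

lemma inner_normal_self (hC : IsConvexCore C) (hc : c ∈ frontier C) :
    ⟪normal C c, normal C c⟫ = 1 := by
  rw [real_inner_self_eq_norm_sq, norm_normal hC hc, one_pow]

lemma frontier_subset (hC : IsConvexCore C) : frontier C ⊆ C :=
  hC.isCompact.isClosed.frontier_subset

lemma isCompact_frontier (hC : IsConvexCore C) : IsCompact (frontier C) :=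
  hC.isCompact.of_isClosed_subset isClosed_frontier (frontier_subset hC)

lemma inner_normal_tangent (v : tangentSpace C c) : ⟪normal C c, (v : E N)⟫ = 0 :=
  Submodule.mem_orthogonal_singleton_iff_inner_right.1 v.2

lemma coe_tangentialProjection (hC : IsConvexCore C) (hc : c ∈ frontier C) (y : E N) :
    ((tangentSpace C c).orthogonalProjectionOnto y : E N) = y - ⟪normal C c, y⟫ • normal C c := by
  rw [← Submodule.starProjection_unit_singleton ℝ (norm_normal hC hc) y]
  simp

/-- Let b be the normalization of a. If ⟪m, b⟫ < 1, the vector m - b pairs negatively with a but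
positively with m, contradicting the hypothesis; and two unit vectors with ⟪m, b⟫ ≥ 1 are equal. -/
lemma eq_inv_norm_smul_of_halfSpace {a m : E N} (hm : ‖m‖ = 1) (ha : a ≠ 0)
    (h : ∀ v, ⟪a, v⟫ < 0 → ⟪m, v⟫ ≤ 0) : m = ‖a‖⁻¹ • a := by
  set b : E N := ‖a‖⁻¹ • a with hb
  have hb1 : ‖b‖ = 1 := norm_smul_inv_norm ha
  have hpos : 0 < ‖a‖ := norm_pos_iff.2 ha
  have hab : a = ‖a‖ • b := by rw [hb, smul_inv_smul₀ hpos.ne']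
  have hmm : ⟪m, m⟫ = 1 := by rw [real_inner_self_eq_norm_sq, hm, one_pow]
  have hbb : ⟪b, b⟫ = 1 := by rw [real_inner_self_eq_norm_sq, hb1, one_pow]
  have key : 1 ≤ ⟪m, b⟫ := by
    by_contra! hlt
    have h1 : ⟪a, m - b⟫ < 0 := by
      rw [hab, real_inner_smul_left, inner_sub_right, hbb, real_inner_comm]
      exact mul_neg_of_pos_of_neg hpos (by linarith)
    have h2 := h _ h1
    rw [inner_sub_right, hmm] at h2
    linarith
  have h3 : ‖m - b‖ ^ 2 ≤ 0 := by
    rw [norm_sub_sq_real, hm, hb1]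
    linarith
  have h4 : ‖m - b‖ = 0 := by
    have := norm_nonneg (m - b)
    nlinarith
  exact sub_eq_zero.1 (norm_eq_zero.1 h4)

/-- `g` is a defining function of `C` near `c`. -/
structure IsDefiningAt (C : Set (E N)) (g : E N → ℝ) (c : E N) : Prop where
  mem_frontier : c ∈ frontier C
  differentiableAt : DifferentiableAt ℝ g c
  gradient_ne_zero : gradient g c ≠ 0
  eventually : ∀ᶠ x in 𝓝 c, (x ∈ C ↔ g x ≤ 0)

lemma hasDerivAt_line {g : E N → ℝ} (hg : DifferentiableAt ℝ g c) (v : E N) :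
    HasDerivAt (fun t : ℝ => g (c + t • v)) ⟪gradient g c, v⟫ 0 := by
  have h1 : HasFDerivAt g (InnerProductSpace.toDual ℝ (E N) (gradient g c)) (c + (0 : ℝ) • v) := by
    simpa using hg.hasGradientAt.hasFDerivAt
  have h2 : HasDerivAt (fun t : ℝ => c + t • v) v 0 := by
    simpa using ((hasDerivAt_id (0 : ℝ)).smul_const v).const_add c
  have h3 := h1.comp_hasDerivAt (0 : ℝ) h2
  rwa [InnerProductSpace.toDual_apply_apply] at h3

lemma tendsto_line (c v : E N) : Tendsto (fun t : ℝ => c + t • v) (𝓝[>] 0) (𝓝 c) := by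
  have : Continuous fun t : ℝ => c + t • v := by fun_prop
  simpa using (this.tendsto 0).mono_left nhdsWithin_le_nhds

namespace IsDefiningAt

variable {g : E N → ℝ}

lemma eq_zero (h : IsDefiningAt C g c) (hC : IsConvexCore C) : g c = 0 := by
  have hcC : c ∈ C := frontier_subset hC h.mem_frontier
  refine le_antisymm (h.eventually.self_of_nhds.1 hcC) ?_
  by_contra! hlt
  apply h.mem_frontier.2
  rw [mem_interior_iff_mem_nhds]
  filter_upwards [h.eventually, h.differentiableAt.continuousAt.eventually_lt_const hlt]
    with x hx hx'
  exact hx.2 hx'.le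

lemma eventually_line_mem (h : IsDefiningAt C g c) (hC : IsConvexCore C) {v : E N}
    (hv : ⟪gradient g c, v⟫ < 0) : ∀ᶠ t : ℝ in 𝓝[>] 0, c + t • v ∈ C := by
  have h1 := (hasDerivAt_line h.differentiableAt v).tendsto_slope_zero_right
  filter_upwards [h1.eventually_lt_const hv, self_mem_nhdsWithin,
    (tendsto_line c v).eventually h.eventually] with t ht ht0 hmem
  have ht0' : (0 : ℝ) < t := ht0
  rw [hmem]
  simp only [zero_add, zero_smul, add_zero, h.eq_zero hC, sub_zero, smul_eq_mul] at ht
  by_contra! hpos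
  exact absurd ht (not_lt.2 (by positivity))

lemma eventually_line_notMem (h : IsDefiningAt C g c) (hC : IsConvexCore C) {v : E N}
    (hv : 0 < ⟪gradient g c, v⟫) : ∀ᶠ t : ℝ in 𝓝[>] 0, c + t • v ∉ C := by
  have h1 := (hasDerivAt_line h.differentiableAt v).tendsto_slope_zero_right
  filter_upwards [h1.eventually_const_lt hv, self_mem_nhdsWithin,
    (tendsto_line c v).eventually h.eventually] with t ht ht0 hmem
  have ht0' : (0 : ℝ) < t := ht0
  rw [hmem, not_le]
  simp only [zero_add, zero_smul, add_zero, h.eq_zero hC, sub_zero, smul_eq_mul] at ht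
  exact (mul_pos_iff_of_pos_left (inv_pos.2 ht0')).1 ht

/-- Descent directions of g enter C, so any outward normal pairs nonpositively with them. This gives
uniqueness of the normal together with its formula. -/
lemma normal_eq (h : IsDefiningAt C g c) (hC : IsConvexCore C) :
    normal C c = ‖gradient g c‖⁻¹ • gradient g c := by
  refine eq_inv_norm_smul_of_halfSpace (norm_normal hC h.mem_frontier) h.gradient_ne_zero
    fun v hv => ?_
  obtain ⟨t, htC, ht0⟩ := ((h.eventually_line_mem hC hv).and self_mem_nhdsWithin).exists
  have h2 := inner_normal_sub_nonpos hC h.mem_frontier htC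
  rw [add_sub_cancel_left, real_inner_smul_right] at h2
  exact nonpos_of_mul_nonpos_right h2 ht0

lemma norm_gradient_pos (h : IsDefiningAt C g c) : 0 < ‖gradient g c‖ :=
  norm_pos_iff.2 h.gradient_ne_zero

lemma gradient_eq (h : IsDefiningAt C g c) (hC : IsConvexCore C) :
    gradient g c = ‖gradient g c‖ • normal C c := by
  rw [h.normal_eq hC, smul_inv_smul₀ h.norm_gradient_pos.ne']

end IsDefiningAt

/-- A single g serves all boundary points near c; this is what turns the pointwise formula for ν
into C¹ regularity. -/
lemma exists_isDefiningAt (hC : IsConvexCore C) (hc : c ∈ frontier C) :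
    ∃ g : E N → ℝ, ContDiffAt ℝ 2 g c ∧ gradient g c ≠ 0 ∧
      ∀ᶠ y in 𝓝[frontier C] c, IsDefiningAt C g y := by
  obtain ⟨g, hg, hg0, hgC⟩ := hC.c2_boundary c hc
  have hgr : gradient g c ≠ 0 := by
    simpa [gradient] using hg0
  refine ⟨g, hg, hgr, ?_⟩
  have hcont : ContinuousAt (fderiv ℝ g) c :=
    (hg.fderiv_right (m := 1) (by norm_num)).continuousAt
  have hne : ∀ᶠ y in 𝓝 c, fderiv ℝ g y ≠ 0 := hcont.eventually_ne hg0
  have hd : ∀ᶠ y in 𝓝 c, DifferentiableAt ℝ g y := by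
    filter_upwards [hg.eventually (by simp)] with y hy
    exact hy.differentiableAt (by simp)
  filter_upwards [self_mem_nhdsWithin, nhdsWithin_le_nhds hne, nhdsWithin_le_nhds hd,
    nhdsWithin_le_nhds hgC.eventually_nhds] with y h1 h2 h3 h4
  exact ⟨h1, h3, by simpa [gradient] using h2, h4⟩

lemma exists_isDefiningAt_self (hC : IsConvexCore C) (hc : c ∈ frontier C) :
    ∃ g : E N → ℝ, IsDefiningAt C g c := by
  obtain ⟨g, -, -, h⟩ := exists_isDefiningAt hC hc
  exact ⟨g, h.self_of_nhdsWithin hc⟩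

/-- Near each boundary point the normal is the restriction of a `C¹` field. -/
lemma exists_contDiffAt_eq_normal (hC : IsConvexCore C) (hc : c ∈ frontier C) :
    ∃ G : E N → E N, ContDiffAt ℝ 1 G c ∧ ∀ᶠ y in 𝓝[frontier C] c, normal C y = G y := by
  obtain ⟨g, hg, hgr, hdef⟩ := exists_isDefiningAt hC hc
  have h1 : ContDiffAt ℝ 1 (gradient g) c :=
    (InnerProductSpace.toDual ℝ (E N)).symm.contDiff.contDiffAt.comp c
      (hg.fderiv_right (m := 1) (by norm_num))
  refine ⟨fun y => ‖gradient g y‖⁻¹ • gradient g y, ?_, hdef.mono fun y hy => hy.normal_eq hC⟩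
  exact ((h1.norm ℝ hgr).inv (norm_ne_zero_iff.2 hgr)).smul h1

lemma differentiableWithinAt_normal (hC : IsConvexCore C) (hc : c ∈ frontier C) :
    DifferentiableWithinAt ℝ (normal C) (frontier C) c := by
  obtain ⟨G, hG, h⟩ := exists_contDiffAt_eq_normal hC hc
  exact (hG.differentiableAt (by simp)).differentiableWithinAt.congr_of_eventuallyEq h
    (h.self_of_nhdsWithin hc)

/-! ### Tangent vectors of the boundary -/

lemma exists_mem_frontier_of_mem_of_notMem {S : Set (E N)} {x y : E N} (hx : x ∈ S) (hy : y ∉ S) :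
    ∃ s ∈ Set.Icc (0 : ℝ) 1, x + s • (y - x) ∈ frontier S := by
  have h : (segment ℝ x y ∩ frontier S).Nonempty := by
    by_contra hne
    have := (convex_segment (𝕜 := ℝ) x y).isPreconnected
    have h1 : segment ℝ x y ⊆ interior S ∪ interior Sᶜ := by
      intro w hw
      by_contra hw'
      apply hne
      refine ⟨w, hw, ?_⟩
      rw [Set.mem_union, not_or, interior_compl, Set.mem_compl_iff, not_not] at hw'
      exact ⟨hw'.2, hw'.1⟩
    have h2 := this _ _ isOpen_interior isOpen_interior h1
    have hx' : x ∈ interior S := (h1 (left_mem_segment ℝ x y)).resolve_right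
      fun h => interior_subset h hx
    have hy' : y ∈ interior Sᶜ := (h1 (right_mem_segment ℝ x y)).resolve_left
      fun h => hy (interior_subset h)
    obtain ⟨w, -, hw1, hw2⟩ := h2 ⟨x, left_mem_segment ℝ x y, hx'⟩ ⟨y, right_mem_segment ℝ x y, hy'⟩
    exact interior_subset hw2 (interior_subset hw1)
  obtain ⟨w, hw, hwS⟩ := h
  rw [segment_eq_image'] at hw
  obtain ⟨s, hs, rfl⟩ := hw
  exact ⟨s, hs, hwS⟩

/-- Tangent vectors are limits of difference quotients of boundary points. -/
lemma exists_seq_tangent (hC : IsConvexCore C) (hc : c ∈ frontier C) (v : tangentSpace C c) :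
    ∃ (t : ℕ → ℝ) (w : ℕ → E N), (∀ n, 0 < t n) ∧ Tendsto t atTop (𝓝 0) ∧
      Tendsto w atTop (𝓝 (v : E N)) ∧ ∀ n, c + t n • w n ∈ frontier C := by
  obtain ⟨g, hg⟩ := exists_isDefiningAt_self hC hc
  have hpos := hg.norm_gradient_pos
  have hin : ∀ ε : ℝ, ⟪gradient g c, (v : E N) + ε • normal C c⟫ = ‖gradient g c‖ * ε := by
    intro ε
    rw [hg.gradient_eq hC, real_inner_smul_left, inner_add_right, inner_normal_tangent,
      real_inner_smul_right, inner_normal_self hC hc, norm_smul, norm_norm, norm_normal hC hc]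
    ring
  have step : ∀ n : ℕ, ∃ (t : ℝ) (w : E N), 0 < t ∧ t < 1 / ((n : ℝ) + 1) ∧
      ‖w - v‖ ≤ 1 / ((n : ℝ) + 1) ∧ c + t • w ∈ frontier C := by
    intro n
    set ε : ℝ := 1 / ((n : ℝ) + 1) with hε
    have hε0 : 0 < ε := by positivity
    -- Tilting v inward by ε gives a direction entering C, tilting it outward one leaving C; the
    -- segment between the two endpoints at time t crosses ∂C at a direction within ε of v.
    have h1 := hg.eventually_line_mem hC (v := (v : E N) + (-ε) • normal C c)
      (by rw [hin]; exact mul_neg_of_pos_of_neg hpos (by linarith))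
    have h2 := hg.eventually_line_notMem hC (v := (v : E N) + ε • normal C c)
      (by rw [hin]; exact mul_pos hpos hε0)
    have h3 : ∀ᶠ t : ℝ in 𝓝[>] 0, t < ε := nhdsWithin_le_nhds (eventually_lt_nhds hε0)
    obtain ⟨t, ⟨⟨h1, h2⟩, h3⟩, h4⟩ := (((h1.and h2).and h3).and self_mem_nhdsWithin).exists
    obtain ⟨s, hs, hmem⟩ := exists_mem_frontier_of_mem_of_notMem h1 h2
    refine ⟨t, (v : E N) + ((2 * s - 1) * ε) • normal C c, h4, h3, ?_, ?_⟩
    · rw [add_sub_cancel_left, norm_smul, norm_normal hC hc, mul_one, norm_mul, Real.norm_eq_abs,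
        Real.norm_eq_abs, abs_of_pos hε0]
      have : |2 * s - 1| ≤ 1 := abs_le.2 ⟨by linarith [hs.1], by linarith [hs.2]⟩
      nlinarith
    · convert hmem using 1
      module
  choose t w ht0 ht hw hmem using step
  refine ⟨t, w, ht0, ?_, ?_, hmem⟩
  · exact squeeze_zero (fun n => (ht0 n).le) (fun n => (ht n).le) tendsto_one_div_add_atTop_nhds_zero_nat
  · rw [tendsto_iff_norm_sub_tendsto_zero]
    exact squeeze_zero (fun n => norm_nonneg _) hw tendsto_one_div_add_atTop_nhds_zero_nat

lemma mem_posTangentConeAt (hC : IsConvexCore C) (hc : c ∈ frontier C) (v : tangentSpace C c) :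
    (v : E N) ∈ posTangentConeAt (frontier C) c := by
  obtain ⟨t, w, ht0, ht, hw, hmem⟩ := exists_seq_tangent hC hc v
  refine mem_tangentConeAt_of_seq atTop (fun n => Real.toNNReal (t n)⁻¹)
    (fun n => t n • w n) (by simpa using ht.smul hw) (Eventually.of_forall hmem) ?_
  refine hw.congr fun n => ?_
  rw [NNReal.smul_def, Real.coe_toNNReal _ (inv_pos.2 (ht0 n)).le]
  exact (inv_smul_smul₀ (ht0 n).ne' _).symm

lemma mem_tangentConeAt (hC : IsConvexCore C) (hc : c ∈ frontier C) (v : tangentSpace C c) :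
    (v : E N) ∈ tangentConeAt ℝ (frontier C) c := by
  obtain ⟨t, w, ht0, ht, hw, hmem⟩ := exists_seq_tangent hC hc v
  refine mem_tangentConeAt_of_seq atTop (fun n => (t n)⁻¹)
    (fun n => t n • w n) (by simpa using ht.smul hw) (Eventually.of_forall hmem) ?_
  exact hw.congr fun n => (inv_smul_smul₀ (ht0 n).ne' _).symm

section Deriv

variable {V : Type*} [NormedAddCommGroup V] [NormedSpace ℝ V]

/-- A derivative within ∂C is not unique in the normal direction, but any two agree on the tangent
cone, which contains the tangent space. -/
lemma tangentialDeriv_eq (hC : IsConvexCore C) (hc : c ∈ frontier C) {f : E N → V}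
    {f' : E N →L[ℝ] V} (hf : HasFDerivWithinAt f f' (frontier C) c) (v : tangentSpace C c) :
    tangentialDeriv C f c v = f' v :=
  (hf.differentiableWithinAt.hasFDerivWithinAt.unique_on hf) (mem_tangentConeAt hC hc v)

lemma tangentialDeriv_eq_zero_of_isMaxOn (hC : IsConvexCore C) (hc : c ∈ frontier C)
    {f : E N → ℝ} {f' : E N →L[ℝ] ℝ} (hf : HasFDerivWithinAt f f' (frontier C) c)
    (hmax : IsMaxOn f (frontier C) c) (v : tangentSpace C c) : f' v = 0 :=
  hmax.localize.hasFDerivWithinAt_eq_zero hf (mem_posTangentConeAt hC hc v)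
    (by simpa using mem_posTangentConeAt hC hc (-v))

/-- The normal component of chords of the boundary is of second order. -/
lemma hasFDerivWithinAt_inner_normal (hC : IsConvexCore C) (hc : c ∈ frontier C) :
    HasFDerivWithinAt (fun y => ⟪normal C c, y⟫) (0 : E N →L[ℝ] ℝ) (frontier C) c := by
  obtain ⟨g, -, -, hg⟩ := exists_isDefiningAt hC hc
  have hgc := hg.self_of_nhdsWithin hc
  have h1 : HasFDerivWithinAt g (InnerProductSpace.toDual ℝ (E N) (gradient g c)) (frontier C) c :=
    hgc.differentiableAt.hasGradientAt.hasFDerivAt.hasFDerivWithinAt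
  -- Because g vanishes on ∂C, zero is also a derivative of g within ∂C, besides its gradient.
  have h2 : HasFDerivWithinAt g (0 : E N →L[ℝ] ℝ) (frontier C) c :=
    (hasFDerivWithinAt_const (0 : ℝ) c _).congr_of_eventuallyEq
      (hg.mono fun y hy => hy.eq_zero hC) (hgc.eq_zero hC)
  have h3 : HasFDerivWithinAt (fun y : E N => ⟪gradient g c, y⟫)
      (InnerProductSpace.toDual ℝ (E N) (gradient g c)) (frontier C) c :=
    (InnerProductSpace.toDual ℝ (E N) (gradient g c)).hasFDerivWithinAt
  have h4 := (h3.sub (h1.sub h2)).const_mul ‖gradient g c‖⁻¹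
  have h5 : HasFDerivWithinAt (fun y : E N => ‖gradient g c‖⁻¹ * ⟪gradient g c, y⟫)
      (0 : E N →L[ℝ] ℝ) (frontier C) c := by
    have := ((h3.sub h1).add h2).const_mul ‖gradient g c‖⁻¹
    simpa using this
  simpa only [hgc.normal_eq hC, real_inner_smul_left] using h5

/-- A differential along the boundary may be precomposed with the tangential projection. -/
lemma hasFDerivWithinAt_tangential (hC : IsConvexCore C) (hc : c ∈ frontier C) {f : E N → V}
    (hf : DifferentiableWithinAt ℝ f (frontier C) c) :
    HasFDerivWithinAt f ((tangentialDeriv C f c).comp (tangentSpace C c).orthogonalProjectionOnto)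
      (frontier C) c := by
  have h1 := hf.hasFDerivWithinAt
  set L := fderivWithin ℝ f (frontier C) c with hL
  have h2 := (hasFDerivWithinAt_inner_normal hC hc).smul_const (L (normal C c))
  have h3 : HasFDerivWithinAt (fun y => ⟪normal C c, y⟫ • L (normal C c))
      (((innerSL ℝ (normal C c) : E N →L[ℝ] ℝ)).smulRight (L (normal C c))) (frontier C) c :=
    ((innerSL ℝ (normal C c) : E N →L[ℝ] ℝ).smulRight (L (normal C c))).hasFDerivWithinAt
  have h4 := (h1.add h2).sub h3
  refine (h4.congr_fderiv ?_).congr (fun y _ => by simp) (by simp)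
  ext y
  simp [tangentialDeriv, coe_tangentialProjection hC hc, ← hL]

end Deriv

/-! ### The shape operator -/

/-- Differentiate ‖ν‖² = 1 along ∂C. -/
lemma inner_normal_tangentialDeriv_normal (hC : IsConvexCore C) (hc : c ∈ frontier C)
    (v : tangentSpace C c) : ⟪normal C c, tangentialDeriv C (normal C) c v⟫ = 0 := by
  have h1 := (differentiableWithinAt_normal hC hc).hasFDerivWithinAt.norm_sq
  have h2 : HasFDerivWithinAt (fun y => ‖normal C y‖ ^ 2) (0 : E N →L[ℝ] ℝ) (frontier C) c :=
    (hasFDerivWithinAt_const (1 : ℝ) c _).congr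
      (fun y hy => by rw [norm_normal hC hy, one_pow]) (by rw [norm_normal hC hc, one_pow])
  have h3 := h1.unique_on h2 (mem_tangentConeAt hC hc v)
  simpa [tangentialDeriv] using h3

lemma coe_shapeOperator (hC : IsConvexCore C) (hc : c ∈ frontier C) (v : tangentSpace C c) :
    (shapeOperator C c v : E N) = -tangentialDeriv C (normal C) c v := by
  have h : (shapeOperator C c v : E N) =
      -((tangentSpace C c).orthogonalProjectionOnto (tangentialDeriv C (normal C) c v) : E N) := rfl
  rw [h, coe_tangentialProjection hC hc, inner_normal_tangentialDeriv_normal hC hc, zero_smul,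
    sub_zero]

/-- With the convention `Dν = -S`, the shape operator of a convex boundary is nonpositive. -/
lemma inner_shapeOperator_nonpos (hC : IsConvexCore C) (hc : c ∈ frontier C)
    (v : tangentSpace C c) : ⟪(v : E N), (shapeOperator C c v : E N)⟫ ≤ 0 := by
  obtain ⟨t, w, ht0, ht, hw, hmem⟩ := exists_seq_tangent hC hc v
  have h1 := (differentiableWithinAt_normal hC hc).hasFDerivWithinAt.lim (l := atTop)
    (c := fun n => (t n)⁻¹) (d := fun n => t n • w n) (v := (v : E N))
    (by simpa using ht.smul hw) (Eventually.of_forall hmem)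
    (hw.congr fun n => (inv_smul_smul₀ (ht0 n).ne' _).symm)
  have h2 : 0 ≤ ⟪(v : E N), tangentialDeriv C (normal C) c v⟫ := by
    refine ge_of_tendsto' (hw.inner h1) fun n => ?_
    -- Monotonicity of the normal: the supporting inequalities at the two ends of the chord, each
    -- tested on the other end.
    have h3 := inner_normal_sub_nonpos hC hc (frontier_subset hC (hmem n))
    have h4 := inner_normal_sub_nonpos hC (hmem n) (frontier_subset hC hc)
    rw [add_sub_cancel_left, real_inner_smul_right] at h3
    rw [sub_add_cancel_left, inner_neg_right, real_inner_smul_right] at h4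
    have h5 : ⟪normal C c, w n⟫ ≤ 0 := nonpos_of_mul_nonpos_right h3 (ht0 n)
    have h6 : 0 ≤ ⟪normal C (c + t n • w n), w n⟫ :=
      nonneg_of_mul_nonneg_right (by linarith) (ht0 n)
    rw [real_inner_smul_right, inner_sub_right, real_inner_comm, real_inner_comm (normal C c)]
    exact mul_nonneg (inv_pos.2 (ht0 n)).le (by linarith)
  rw [coe_shapeOperator hC hc, inner_neg_right]
  linarith

/-- The spaces on which S acts vary with c, so the bound is obtained locally from a C¹ extension of
ν and made uniform by compactness. -/
lemma exists_norm_shapeOperator_le (hC : IsConvexCore C) :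
    ∃ K : ℝ, 0 ≤ K ∧ ∀ c ∈ frontier C, ∀ v, ‖(shapeOperator C c v : E N)‖ ≤ K * ‖(v : E N)‖ := by
  refine (isCompact_frontier hC).induction_on (p := fun s => ∃ K : ℝ, 0 ≤ K ∧
    ∀ c ∈ s, c ∈ frontier C → ∀ v, ‖(shapeOperator C c v : E N)‖ ≤ K * ‖(v : E N)‖)
    ⟨0, le_rfl, by simp⟩ ?_ ?_ ?_ |>.imp fun K h => ⟨h.1, fun c hc => h.2 c hc hc⟩
  · rintro s t hst ⟨K, hK0, hK⟩
    exact ⟨K, hK0, fun c hc => hK c (hst hc)⟩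
  · rintro s t ⟨K, hK0, hK⟩ ⟨K', hK0', hK'⟩
    refine ⟨K + K', add_nonneg hK0 hK0', ?_⟩
    rintro c (hc | hc) hcC v
    · refine (hK c hc hcC v).trans ?_
      gcongr
      linarith
    · refine (hK' c hc hcC v).trans ?_
      gcongr
      linarith
  · intro c hc
    obtain ⟨G, hG, h⟩ := exists_contDiffAt_eq_normal hC hc
    have h1 : ∀ᶠ y in 𝓝 c, ‖fderiv ℝ G y‖ < ‖fderiv ℝ G c‖ + 1 :=
      (hG.fderiv_right (m := 0) (by norm_num)).continuousAt.norm.eventually_lt_const (by linarith)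
    have h2 : ∀ᶠ y in 𝓝 c, DifferentiableAt ℝ G y :=
      (hG.eventually (by simp)).mono fun y hy => hy.differentiableAt (by simp)
    refine ⟨_, inter_mem (inter_mem (nhdsWithin_le_nhds h1) (nhdsWithin_le_nhds h2))
      (eventually_eventually_nhdsWithin.2 h), ‖fderiv ℝ G c‖ + 1, by positivity, ?_⟩
    rintro y ⟨⟨hy1, hy2⟩, hy3⟩ hy v
    have hy2' : DifferentiableAt ℝ G y := hy2
    have hy3' : ∀ᶠ z in 𝓝[frontier C] y, normal C z = G z := hy3
    have hd := hy2'.hasFDerivAt.hasFDerivWithinAt.congr_of_eventuallyEq hy3'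
      (hy3'.self_of_nhdsWithin hy)
    rw [coe_shapeOperator hC hy, norm_neg, tangentialDeriv_eq hC hy hd]
    refine ((fderiv ℝ G y).le_opNorm _).trans ?_
    gcongr
    exact le_of_lt hy1

/-! ### Paths in the boundary and a Gronwall principle -/

lemma exists_orthogonal_ne_zero (hN : 2 ≤ N) (a : E N) : ∃ e : E N, e ≠ 0 ∧ ⟪e, a⟫ = 0 := by
  have h1 := Submodule.finrank_add_finrank_orthogonal (ℝ ∙ a)
  have h2 : Module.finrank ℝ (ℝ ∙ a) ≤ 1 :=
    (finrank_span_le_card ({a} : Set (E N))).trans (by simp)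
  rw [finrank_euclideanSpace_fin] at h1
  have h3 : (ℝ ∙ a)ᗮ ≠ ⊥ := by
    intro h
    rw [h, finrank_bot] at h1
    omega
  obtain ⟨e, he, he0⟩ := Submodule.exists_mem_ne_zero_of_ne_bot h3
  exact ⟨e, he0, Submodule.mem_orthogonal_singleton_iff_inner_left.1 he⟩

/-- Some interior point does not lie on the line through two given points. -/
lemma exists_center (hN : 2 ≤ N) (hC : IsConvexCore C) (c₀ c₁ : E N) :
    ∃ o ∈ interior C, ∀ t : ℝ, c₀ - o + t • (c₁ - c₀) ≠ 0 := by
  obtain ⟨e, he0, he⟩ := exists_orthogonal_ne_zero hN (c₁ - c₀)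
  obtain ⟨p, hp⟩ := hC.nonempty_interior
  have hee : 0 < ⟪e, e⟫ := real_inner_self_pos.2 he0
  have h1 : ∀ᶠ s : ℝ in 𝓝[≠] 0, p + s • e ∈ interior C := by
    have hcont : Continuous fun s : ℝ => p + s • e := by fun_prop
    refine nhdsWithin_le_nhds (hcont.tendsto 0 |>.eventually (isOpen_interior.mem_nhds ?_))
    simpa using hp
  -- With e orthogonal to c₁ - c₀, it suffices to move o along e until ⟪e, c₀ - o⟫ ≠ 0.
  have h2 : ∃ᶠ s : ℝ in 𝓝[≠] 0, ⟪e, c₀ - (p + s • e)⟫ ≠ 0 := by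
    intro h
    simp only [not_not] at h
    have hcont : Continuous fun s : ℝ => ⟪e, c₀ - (p + s • e)⟫ := by fun_prop
    have h0 : ⟪e, c₀ - (p + (0 : ℝ) • e)⟫ = 0 :=
      tendsto_nhds_unique ((hcont.tendsto 0).mono_left nhdsWithin_le_nhds)
        (tendsto_const_nhds.congr' (h.mono fun s hs => hs.symm))
    obtain ⟨s, hs, hs0⟩ := (h.and self_mem_nhdsWithin).exists
    rw [zero_smul, add_zero] at h0
    rw [← sub_sub, inner_sub_right, h0, real_inner_smul_right, zero_sub, neg_eq_zero] at hs
    exact (mul_ne_zero hs0 hee.ne') hs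
  obtain ⟨s, hs, hsC⟩ := (h2.and_eventually h1).exists
  refine ⟨p + s • e, hsC, fun t ht => hs ?_⟩
  have := congrArg (fun x => ⟪e, x⟫) ht
  simpa [inner_add_right, real_inner_smul_right, he] using this

/-- Two points of the boundary are joined by a Lipschitz path in the boundary. -/
lemma exists_lipschitz_path (hN : 2 ≤ N) (hC : IsConvexCore C) {c₀ c₁ : E N}
    (h₀ : c₀ ∈ frontier C) (h₁ : c₁ ∈ frontier C) :
    ∃ (γ : ℝ → E N) (Λ : ℝ), 0 < Λ ∧ γ 0 = c₀ ∧ γ 1 = c₁ ∧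
      (∀ t, γ t ∈ frontier C) ∧
      ∀ s ∈ Set.Icc (0 : ℝ) 1, ∀ t ∈ Set.Icc (0 : ℝ) 1, ‖γ s - γ t‖ ≤ Λ * |s - t| := by
  obtain ⟨o, ho, hline⟩ := exists_center hN hC c₀ c₁
  set D : Set (E N) := (fun x => o + x) ⁻¹' C with hD
  have hfr : ∀ x, o + x ∈ frontier C ↔ x ∈ frontier D := by
    intro x
    rw [hD]
    exact Set.ext_iff.1 ((Homeomorph.addLeft o).preimage_frontier C) x
  have hDconv : Convex ℝ D := hC.convex.translate_preimage_right o
  have hD0 : D ∈ 𝓝 (0 : E N) := by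
    have hcont : Continuous fun x : E N => o + x := by fun_prop
    refine hcont.continuousAt.preimage_mem_nhds ?_
    simpa using mem_interior_iff_mem_nhds.1 ho
  have hDb : Bornology.IsVonNBounded ℝ D := by
    rw [NormedSpace.isVonNBounded_iff]
    exact ((Homeomorph.addLeft o).isCompact_preimage.2 hC.isCompact).isBounded
  have habs : Absorbent ℝ D := absorbent_nhds_zero hD0
  obtain ⟨k, hk⟩ := hDconv.lipschitz_gauge hD0
  -- The path is the radial projection from o of the segment from c₀ to c₁: divide by the gauge of C
  -- centred at o, which is Lipschitz and stays at least m > 0 on [0, 1].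
  set w : ℝ → E N := fun t => c₀ - o + t • (c₁ - c₀) with hw
  have hwcont : Continuous w := by fun_prop
  set ρ : ℝ → ℝ := fun t => gauge D (w t) with hρ
  have hρcont : Continuous ρ := hk.continuous.comp hwcont
  have hρpos : ∀ t, 0 < ρ t := fun t => (gauge_pos habs hDb).2 (hline t)
  obtain ⟨t₀, -, hmin⟩ := isCompact_Icc.exists_isMinOn
    (Set.nonempty_Icc.2 (zero_le_one (α := ℝ))) hρcont.continuousOn
  obtain ⟨B, hB⟩ := isCompact_Icc.exists_bound_of_continuousOn (s := Set.Icc (0 : ℝ) 1)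
    hwcont.continuousOn
  have hB0 : 0 ≤ B := (norm_nonneg _).trans (hB 0 (by simp))
  set m := ρ t₀
  have hm : 0 < m := hρpos t₀
  set ℓ := ‖c₁ - c₀‖
  have hwl : ∀ s t, ‖w s - w t‖ = |s - t| * ℓ := by
    intro s t
    rw [← Real.norm_eq_abs, ← norm_smul]
    congr 1
    simp only [hw]
    module
  have hρl : ∀ s t, |ρ s - ρ t| ≤ k * (|s - t| * ℓ) := by
    intro s t
    rw [← hwl, ← Real.norm_eq_abs]
    exact hk.norm_sub_le _ _
  have hone : ∀ x, o + x ∈ frontier C → gauge D x = 1 := fun x hx =>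
    (gauge_eq_one_iff_mem_frontier hDconv hD0).2 ((hfr x).1 hx)
  refine ⟨fun t => o + (ρ t)⁻¹ • w t, m⁻¹ * ℓ + k * ℓ / m ^ 2 * B + 1, by positivity,
    ?_, ?_, ?_, ?_⟩
  · have : ρ 0 = 1 := hone _ (by simpa [hw] using h₀)
    simp [this, hw]
  · have : ρ 1 = 1 := hone _ (by simpa [hw] using h₁)
    simp [this, hw]
  · intro t
    rw [hfr, ← gauge_eq_one_iff_mem_frontier hDconv hD0,
      gauge_smul_of_nonneg (inv_pos.2 (hρpos t)).le, smul_eq_mul]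
    exact inv_mul_cancel₀ (hρpos t).ne'
  · intro s hs t ht
    have hms : m ≤ ρ s := hmin hs
    have hmt : m ≤ ρ t := hmin ht
    have hinv : |(ρ s)⁻¹ - (ρ t)⁻¹| ≤ k * ℓ / m ^ 2 * |s - t| := by
      rw [inv_sub_inv (hρpos s).ne' (hρpos t).ne', abs_div, abs_sub_comm,
        abs_of_pos (mul_pos (hρpos s) (hρpos t)), div_mul_eq_mul_div]
      refine div_le_div₀ (by positivity) ((hρl s t).trans (le_of_eq (by ring))) (by positivity) ?_
      nlinarith
    have hdec : o + (ρ s)⁻¹ • w s - (o + (ρ t)⁻¹ • w t) =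
        (ρ s)⁻¹ • (w s - w t) + ((ρ s)⁻¹ - (ρ t)⁻¹) • w t := by module
    calc ‖o + (ρ s)⁻¹ • w s - (o + (ρ t)⁻¹ • w t)‖
        ≤ ‖(ρ s)⁻¹ • (w s - w t)‖ + ‖((ρ s)⁻¹ - (ρ t)⁻¹) • w t‖ := by
          rw [hdec]
          exact norm_add_le _ _
      _ = (ρ s)⁻¹ * (|s - t| * ℓ) + |(ρ s)⁻¹ - (ρ t)⁻¹| * ‖w t‖ := by
          rw [norm_smul, norm_smul, hwl, Real.norm_eq_abs, Real.norm_eq_abs,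
            abs_of_pos (inv_pos.2 (hρpos s))]
      _ ≤ m⁻¹ * (|s - t| * ℓ) + k * ℓ / m ^ 2 * |s - t| * B := by
          gcongr
          exact hB t ht
      _ ≤ (m⁻¹ * ℓ + k * ℓ / m ^ 2 * B + 1) * |s - t| := by
          nlinarith [abs_nonneg (s - t)]

/-- A function on the boundary whose differential is controlled by its values vanishes identically
as soon as it vanishes at one point. -/
lemma eq_zero_of_tangentialDeriv_le (hN : 2 ≤ N) (hC : IsConvexCore C) {f : E N → ℝ} {K : ℝ} (hK0 : 0 ≤ K)
    (hf : DifferentiableOn ℝ f (frontier C))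
    (hK : ∀ c ∈ frontier C, ∀ v, |tangentialDeriv C f c v| ≤ K * |f c| * ‖(v : E N)‖)
    {c₀ : E N} (hc₀ : c₀ ∈ frontier C) (hf₀ : f c₀ = 0) (hc : c ∈ frontier C) : f c = 0 := by
  obtain ⟨γ, Λ, hΛ, h0, h1, hγ, hlip⟩ := exists_lipschitz_path hN hC hc₀ hc
  have hγc : ContinuousOn γ (Set.Icc 0 1) := by
    refine (LipschitzOnWith.of_dist_le_mul (K := Λ.toNNReal) fun s hs t ht => ?_).continuousOn
    rw [dist_eq_norm, Real.dist_eq, Real.coe_toNNReal _ hΛ.le]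
    exact hlip s hs t ht
  have hfγ : ContinuousOn (fun t => |f (γ t)|) (Set.Icc 0 1) :=
    (hf.continuousOn.comp hγc fun t _ => hγ t).abs
  -- The path is only Lipschitz, so Gronwall is used in its form with a lower right Dini derivative
  -- of |f ∘ γ|.
  have key := le_gronwallBound_of_liminf_deriv_right_le (f' := fun t => K * Λ * |f (γ t)|)
    (δ := 0) (K := K * Λ) (ε := 0) hfγ ?_ (by simp [h0, hf₀]) (fun x _ => by simp) 1 (by simp)
  · rw [gronwallBound_ε0_δ0, h1] at key
    exact abs_nonpos_iff.1 key
  · intro x hx r hr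
    have hd := hasFDerivWithinAt_tangential hC (hγ x) (hf _ (hγ x))
    set L := (tangentialDeriv C f (γ x)).comp (tangentSpace C (γ x)).orthogonalProjectionOnto
    have hL : ∀ y, |L y| ≤ K * |f (γ x)| * ‖y‖ := by
      intro y
      refine (hK _ (hγ x) _).trans ?_
      gcongr
      exact Submodule.norm_orthogonalProjectionOnto_apply_le _ y
    -- Half of the room between r and KΛ|f|, divided by Λ to absorb the speed of the path.
    set ε : ℝ := (r - K * Λ * |f (γ x)|) / (2 * Λ) with hε
    have hε0 : 0 < ε := by
      have : 0 < r - K * Λ * |f (γ x)| := sub_pos.2 hr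
      positivity
    have hεr : (ε + K * |f (γ x)|) * Λ < r := by
      have h2 : ε * Λ = (r - K * Λ * |f (γ x)|) / 2 := by
        rw [hε]
        field_simp
      have : K * Λ * |f (γ x)| < r := hr
      linarith
    have hIoo : Set.Ioo x 1 ∈ 𝓝[>] x := Ioo_mem_nhdsGT hx.2
    have htend : Tendsto γ (𝓝[>] x) (𝓝[frontier C] (γ x)) := by
      refine tendsto_nhdsWithin_iff.2 ⟨?_, Eventually.of_forall hγ⟩
      refine (hγc x ⟨hx.1, hx.2.le⟩).mono_left (nhdsWithin_le_iff.2 ?_)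
      filter_upwards [hIoo] with z hz
      exact ⟨hx.1.trans hz.1.le, hz.2.le⟩
    refine Eventually.frequently ?_
    filter_upwards [hIoo, htend.eventually (hd.isLittleO.def hε0)] with z hz hzf
    have hzx : 0 < z - x := sub_pos.2 hz.1
    have hstep : ‖γ z - γ x‖ ≤ Λ * (z - x) := by
      rw [← abs_of_pos hzx]
      exact hlip z ⟨hx.1.trans hz.1.le, hz.2.le⟩ x ⟨hx.1, hx.2.le⟩
    have hdiff : |f (γ z)| - |f (γ x)| ≤ (ε + K * |f (γ x)|) * Λ * (z - x) := by
      calc |f (γ z)| - |f (γ x)| ≤ |f (γ z) - f (γ x)| := abs_sub_abs_le_abs_sub _ _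
        _ = |(f (γ z) - f (γ x) - L (γ z - γ x)) + L (γ z - γ x)| := by rw [sub_add_cancel]
        _ ≤ ε * ‖γ z - γ x‖ + K * |f (γ x)| * ‖γ z - γ x‖ :=
          (abs_add_le _ _).trans (add_le_add hzf (hL _))
        _ = (ε + K * |f (γ x)|) * ‖γ z - γ x‖ := by ring
        _ ≤ (ε + K * |f (γ x)|) * (Λ * (z - x)) := by gcongr
        _ = _ := by ring
    calc (z - x)⁻¹ * (|f (γ z)| - |f (γ x)|)
        ≤ (z - x)⁻¹ * ((ε + K * |f (γ x)|) * Λ * (z - x)) := by gcongr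
      _ = (ε + K * |f (γ x)|) * Λ := by field_simp
      _ < r := hεr

variable {Ω : Set (E N)} {F : frontier C → frontier C}

/-! ### The first order equation satisfied by the thickness -/

/-- Near x, the open cone around n lies in Ω and the opposite cone in its complement, so neither
meets ∂Ω. Hence ⟪n, y - x⟫ is o(‖y - x‖) along ∂Ω. -/
lemma IsInwardUnitNormal.hasFDerivWithinAt {x n : E N} (hΩ : IsOpen Ω)
    (hn : IsInwardUnitNormal Ω x n) :
    HasFDerivWithinAt (fun y => ⟪n, y⟫) (0 : E N →L[ℝ] ℝ) (frontier Ω) x := by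
  refine HasFDerivWithinAt.of_isLittleO (Asymptotics.isLittleO_iff.2 fun ε hε => ?_)
  filter_upwards [self_mem_nhdsWithin, nhdsWithin_le_nhds (hn.2 ε hε).eventually_nhds]
    with y hy hloc
  rw [zero_apply, sub_zero, ← inner_sub_right, Real.norm_eq_abs, abs_le]
  have hc1 : Continuous fun y : E N => ⟪n, y - x⟫ := by fun_prop
  have hc2 : Continuous fun y : E N => ε * ‖y - x‖ := by fun_prop
  constructor
  · by_contra! hlt
    have hev : ∀ᶠ z in 𝓝 y, z ∉ Ω := by
      filter_upwards [hloc, hc1.continuousAt.eventually_lt hc2.neg.continuousAt hlt] with z hz hz'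
      exact hz.2 hz'
    exact mem_closure_iff_frequently.1 hy.1 hev
  · by_contra! hlt
    exact hy.2 (hΩ.interior_eq.symm ▸ hloc.self_of_nhds.1 hlt)

namespace IsReturnGeometry

/-- If d(c) = 0 then Φ(c) = c lies in C, where the reciprocal map is not defined. -/
lemma thickness_pos (hC : IsConvexCore C) (h : IsReturnGeometry C Ω F) (hc : c ∈ frontier C) :
    0 < thickness C Ω c := by
  have h0 : 0 ≤ thickness C Ω c := Real.sSup_nonneg fun r hr => hr.1
  refine h0.lt_of_ne' fun h1 => ?_
  obtain ⟨⟨-, hx⟩, -⟩ := h.isReturnMap ⟨c, hc⟩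
  apply hx
  simpa [radialMap, h1] using frontier_subset hC hc

lemma differentiableOn_thickness (h : IsReturnGeometry C Ω F) :
    DifferentiableOn ℝ (thickness C Ω) (frontier C) :=
  h.smooth.differentiableOn (by simp)

lemma hasFDerivWithinAt_radialMap (hC : IsConvexCore C) (h : IsReturnGeometry C Ω F)
    (hc : c ∈ frontier C) :
    HasFDerivWithinAt (radialMap C Ω)
      (ContinuousLinearMap.id ℝ (E N) +
        (thickness C Ω c • fderivWithin ℝ (normal C) (frontier C) c +
        (fderivWithin ℝ (thickness C Ω) (frontier C) c).smulRight (normal C c))) (frontier C) c :=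
  (hasFDerivWithinAt_id c _).add
    ((h.differentiableOn_thickness c hc).hasFDerivWithinAt.smul
      (differentiableWithinAt_normal hC hc).hasFDerivWithinAt)

/-- The displacement of the return map determines the differential of the thickness. -/
lemma mul_tangentialDeriv (hC : IsConvexCore C) (h : IsReturnGeometry C Ω F) (c : frontier C)
    (v : tangentSpace C (c : E N)) :
    (thickness C Ω c - ⟪normal C c, (F c : E N) - c⟫) * tangentialDeriv C (thickness C Ω) c v =
      ⟪(F c : E N) - c, (v : E N)⟫ -
        thickness C Ω c * ⟪(F c : E N) - c, (shapeOperator C c v : E N)⟫ := by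
  obtain ⟨-, n, hn, t, -, hF⟩ := h.isReturnMap c
  have hΦ := h.hasFDerivWithinAt_radialMap hC c.2
  -- Φ maps ∂C into ∂Ω, so y ↦ ⟪n, Φ(y)⟫ has derivative zero at c; comparison with the chain rule
  -- yields ⟪n, DΦ(v)⟫ = 0.
  have h1 := (hn.hasFDerivWithinAt h.inClass.isOpen).comp (c : E N) hΦ
    (fun y hy => (h.isReturnMap ⟨y, hy⟩).1.1)
  have h2 := ((innerSL ℝ n : E N →L[ℝ] ℝ).hasFDerivAt (x := radialMap C Ω c)).comp_hasFDerivWithinAt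
    (c : E N) hΦ
  have h3 := h2.unique_on h1 (mem_tangentConeAt hC c.2 v)
  have hS := coe_shapeOperator hC c.2 v
  have hS' : fderivWithin ℝ (normal C) (frontier C) (c : E N) v = -(shapeOperator C c v : E N) := by
    rw [hS, neg_neg]
    rfl
  have hD : fderivWithin ℝ (thickness C Ω) (frontier C) (c : E N) v =
    tangentialDeriv C (thickness C Ω) c v := rfl
  simp only [ContinuousLinearMap.comp_apply, add_apply,
    smul_apply, ContinuousLinearMap.smulRight_apply, hS', hD, innerSL_apply_apply,
    ContinuousLinearMap.id_apply, inner_add_right, real_inner_smul_right, inner_neg_right,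
    zero_apply] at h3
  have hz : (F c : E N) - c = thickness C Ω c • normal C c + t • n := by
    rw [hF, radialMap]
    module
  have hv : ⟪normal C c, (v : E N)⟫ = 0 := inner_normal_tangent v
  have hSv : ⟪normal C c, (shapeOperator C c v : E N)⟫ = 0 := inner_normal_tangent _
  rw [hz]
  simp only [inner_add_left, inner_add_right, real_inner_smul_left, real_inner_smul_right, hv, hSv,
    inner_normal_self hC c.2, real_inner_comm n]
  linear_combination -t * h3

end IsReturnGeometry

/-- The tangential part of the displacement of the return map. -/
def tangentialDisplacement (F : frontier C → frontier C) (c : frontier C) :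
    tangentSpace C (c : E N) :=
  (tangentSpace C (c : E N)).orthogonalProjectionOnto ((F c : E N) - c)

lemma inner_displacement (c : frontier C) (v : tangentSpace C (c : E N)) :
    ⟪(F c : E N) - c, (v : E N)⟫ = ⟪(tangentialDisplacement F c : E N), (v : E N)⟫ := by
  rw [tangentialDisplacement]
  exact (Submodule.inner_orthogonalProjectionOnto_eq_of_mem_right v _).symm

/-- At a critical point the equation tested on v = τ reads ‖τ‖² = d⟪τ, S τ⟫ ≤ 0. Conversely, τ = 0
kills the right side, and d - q > 0 can be cancelled. The right-hand condition involves F alone. -/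
lemma IsReturnGeometry.mem_criticalSet_iff (hC : IsConvexCore C) (h : IsReturnGeometry C Ω F)
    (c : frontier C) : (c : E N) ∈ criticalSet C Ω ↔ tangentialDisplacement F c = 0 := by
  have hd := h.thickness_pos hC c.2
  have hq := inner_normal_sub_nonpos hC c.2 (frontier_subset hC (F c).2)
  have hcrit : (c : E N) ∈ criticalSet C Ω ↔ tangentialDeriv C (thickness C Ω) c = 0 := by
    simp [criticalSet, tangentialGradient]
  rw [hcrit]
  constructor
  · intro h0
    have h1 := h.mul_tangentialDeriv hC c (tangentialDisplacement F c)
    rw [h0, zero_apply, mul_zero, inner_displacement, inner_displacement,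
      real_inner_self_eq_norm_sq] at h1
    have h2 := inner_shapeOperator_nonpos hC c.2 (tangentialDisplacement F c)
    have h3 : ‖(tangentialDisplacement F c : E N)‖ ^ 2 ≤ 0 := by nlinarith
    have h4 : (tangentialDisplacement F c : E N) = 0 := by
      rw [← norm_eq_zero]
      exact pow_eq_zero_iff (two_ne_zero) |>.1 (le_antisymm h3 (by positivity))
    exact_mod_cast h4
  · intro h0
    ext v
    have h1 := h.mul_tangentialDeriv hC c v
    rw [inner_displacement, inner_displacement, h0] at h1
    simp only [Submodule.coe_zero, inner_zero_left, mul_zero, sub_zero] at h1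
    exact (mul_eq_zero.1 h1).resolve_left (by linarith)

variable {Ω' : Set (E N)}

/-! ### The geometric operator at critical points -/

/-- As S ≤ 0, ⟪v, (I - rS)v⟫ ≥ ‖v‖², so the operator is injective, hence bijective in finite
dimension. -/
lemma isUnit_id_sub_smul_shapeOperator (hC : IsConvexCore C) (hc : c ∈ frontier C) {r : ℝ}
    (hr : 0 ≤ r) :
    IsUnit (ContinuousLinearMap.id ℝ (tangentSpace C c) - r • shapeOperator C c) := by
  rw [ContinuousLinearMap.isUnit_iff_bijective]
  set M := ContinuousLinearMap.id ℝ (tangentSpace C c) - r • shapeOperator C c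
  have hinj : Function.Injective (M : tangentSpace C c →ₗ[ℝ] tangentSpace C c) := by
    rw [injective_iff_map_eq_zero]
    intro v hv
    have h0 : (v : E N) - r • (shapeOperator C c v : E N) = 0 := congrArg Subtype.val hv
    have h1 : ⟪(v : E N), (v : E N) - r • (shapeOperator C c v : E N)⟫ = 0 := by
      rw [h0, inner_zero_right]
    rw [inner_sub_right, real_inner_smul_right] at h1
    have h2 := inner_shapeOperator_nonpos hC hc v
    have h3 : ⟪(v : E N), (v : E N)⟫ = 0 :=
      le_antisymm (by nlinarith) real_inner_self_nonneg
    exact_mod_cast inner_self_eq_zero.1 h3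
  exact ⟨hinj, LinearMap.injective_iff_surjective.1 hinj⟩

lemma geomOperator_apply_sub (hC : IsConvexCore C) (h : IsReturnGeometry C Ω F)
    (hc : c ∈ frontier C) (v : tangentSpace C c) :
    geomOperator C Ω c v - thickness C Ω c • shapeOperator C c (geomOperator C Ω c v) =
      (2 * thickness C Ω c) • v := by
  have hu := isUnit_id_sub_smul_shapeOperator hC hc (h.thickness_pos hC hc).le
  set R := Ring.inverse
    (ContinuousLinearMap.id ℝ (tangentSpace C c) - thickness C Ω c • shapeOperator C c)
  have h1 : R v - thickness C Ω c • shapeOperator C c (R v) = v :=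
    congrArg (fun T => T v) (Ring.mul_inverse_cancel _ hu)
  have h2 : geomOperator C Ω c v = (2 * thickness C Ω c) • R v := rfl
  rw [h2, map_smul, smul_comm, ← smul_sub, h1]

lemma exists_tangent_ne_zero (hN : 2 ≤ N) (C : Set (E N)) (c : E N) :
    ∃ v : tangentSpace C c, v ≠ 0 := by
  obtain ⟨e, he, h⟩ := exists_orthogonal_ne_zero hN (normal C c)
  exact ⟨⟨e, Submodule.mem_orthogonal_singleton_iff_inner_left.2 h⟩, fun h0 => he
    (congrArg Subtype.val h0)⟩

/-- An eigenvalue of the geometric operator determines one of the shape operator. -/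
lemma shapeOperator_apply_of_eigenvector (hC : IsConvexCore C) (h : IsReturnGeometry C Ω F)
    (hc : c ∈ frontier C) {v : tangentSpace C c} (hv : v ≠ 0) {a : ℝ}
    (hA : geomOperator C Ω c v = a • v) :
    shapeOperator C c v = (1 / thickness C Ω c - 2 / a) • v := by
  have hd := h.thickness_pos hC hc
  have h1 := geomOperator_apply_sub hC h hc v
  rw [hA, map_smul] at h1
  have ha : a ≠ 0 := by
    rintro rfl
    simp only [zero_smul, smul_zero, sub_zero] at h1
    exact smul_ne_zero (by positivity) hv h1.symm
  set d := thickness C Ω c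
  have h2 : (d * a) • shapeOperator C c v = (a - 2 * d) • v := by
    rw [sub_smul, ← h1, mul_smul]
    abel
  have h3 : (d * a) • shapeOperator C c v = (d * a) • ((1 / d - 2 / a) • v) := by
    rw [h2, smul_smul]
    congr 1
    field_simp
  exact smul_right_injective _ (mul_ne_zero hd.ne' ha) h3

lemma inv_sub_inv_of_isotropic (hN : 2 ≤ N) (hC : IsConvexCore C) (h : IsReturnGeometry C Ω F)
    (h' : IsReturnGeometry C Ω' F) (hc : c ∈ frontier C) {a a' : ℝ}
    (hA : geomOperator C Ω c = a • ContinuousLinearMap.id ℝ (tangentSpace C c))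
    (hA' : geomOperator C Ω' c = a' • ContinuousLinearMap.id ℝ (tangentSpace C c)) :
    1 / thickness C Ω' c - 1 / thickness C Ω c = 2 / a' - 2 / a := by
  obtain ⟨v, hv⟩ := exists_tangent_ne_zero hN C c
  have h1 := shapeOperator_apply_of_eigenvector hC h hc hv (a := a) (by simp [hA])
  have h2 := shapeOperator_apply_of_eigenvector hC h' hc hv (a := a') (by simp [hA'])
  have h3 := smul_left_injective ℝ hv (h1.symm.trans h2)
  linarith

/-- With w = Av, cross-multiplying the identities w - dSw = 2dv and w - d'Sw = 2d'v cancels both S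
and v, leaving (d' - d)w = 0. -/
lemma thickness_eq_of_geomOperator_eq (hN : 2 ≤ N) (hC : IsConvexCore C)
    (h : IsReturnGeometry C Ω F) (h' : IsReturnGeometry C Ω' F) (hc : c ∈ frontier C)
    (hA : geomOperator C Ω c = geomOperator C Ω' c) : thickness C Ω c = thickness C Ω' c := by
  obtain ⟨v, hv⟩ := exists_tangent_ne_zero hN C c
  have hd := h.thickness_pos hC hc
  have h1 := geomOperator_apply_sub hC h hc v
  have h2 := geomOperator_apply_sub hC h' hc v
  rw [← hA] at h2
  set w := geomOperator C Ω c v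
  set d := thickness C Ω c
  set d' := thickness C Ω' c
  have h3 : (d' - d) • w = 0 := by
    have : (d' - d) • w = d' • (w - d • shapeOperator C c w) -
        d • (w - d' • shapeOperator C c w) := by module
    rw [this, h1, h2]
    module
  rcases smul_eq_zero.1 h3 with h4 | h4
  · linarith
  · rw [h4, map_zero, smul_zero, sub_zero] at h1
    exact absurd h1.symm (smul_ne_zero (by positivity) hv)

/-- The eigenbases may differ, so compare traces: tr S = (N - 1)/d - ∑ 2/aᵢ, and likewise for d'. -/
lemma thickness_eq_of_eigenbasis (hN : 2 ≤ N) (hC : IsConvexCore C)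
    (h : IsReturnGeometry C Ω F) (h' : IsReturnGeometry C Ω' F) (hc : c ∈ frontier C)
    {a : Fin (N - 1) → ℝ} (b b' : Module.Basis (Fin (N - 1)) ℝ (tangentSpace C c))
    (hb : ∀ i, geomOperator C Ω c (b i) = a i • b i)
    (hb' : ∀ i, geomOperator C Ω' c (b' i) = a i • b' i) :
    thickness C Ω c = thickness C Ω' c := by
  have trace_eq : ∀ (e : Module.Basis (Fin (N - 1)) ℝ (tangentSpace C c)) (x : Fin (N - 1) → ℝ),
      (∀ i, shapeOperator C c (e i) = x i • e i) →
      LinearMap.trace ℝ _ (shapeOperator C c : tangentSpace C c →ₗ[ℝ] tangentSpace C c) =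
        ∑ i, x i := by
    intro e x hx
    rw [LinearMap.trace_eq_matrix_trace ℝ e, Matrix.trace]
    refine Finset.sum_congr rfl fun i _ => ?_
    simp [LinearMap.toMatrix_apply, hx]
  have h1 := trace_eq b _ fun i => shapeOperator_apply_of_eigenvector hC h hc (b.ne_zero i) (hb i)
  have h2 := trace_eq b' _ fun i =>
    shapeOperator_apply_of_eigenvector hC h' hc (b'.ne_zero i) (hb' i)
  rw [h1, Finset.sum_sub_distrib, Finset.sum_sub_distrib, Finset.sum_const, Finset.sum_const,
    Finset.card_univ, Fintype.card_fin, nsmul_eq_mul, nsmul_eq_mul, sub_left_inj] at h2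
  have hN' : ((N - 1 : ℕ) : ℝ) ≠ 0 := by
    rw [Nat.cast_ne_zero]
    omega
  simpa using mul_left_cancel₀ hN' h2

/-- Each of the constraints prescribes the thickness at critical points, up to a constant shift of its
reciprocal. -/
lemma exists_inv_sub_inv_eq (hN : 2 ≤ N) (hC : IsConvexCore C) (h : IsReturnGeometry C Ω F)
    (h' : IsReturnGeometry C Ω' F) (hA : SameConstraint C Ω Ω') :
    ∃ k : ℝ, ∀ c : frontier C, tangentialDisplacement F c = 0 →
      1 / thickness C Ω' c - 1 / thickness C Ω c = k := by
  have hcrit := h.mem_criticalSet_iff hC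
  have hcrit' := h'.mem_criticalSet_iff hC
  rcases hA with (⟨α, h1, h2⟩ | ⟨a, a', h1, h2⟩) | ⟨α, h1, h2⟩ | ⟨A, h1, h2⟩
  · refine ⟨0, fun c hc => ?_⟩
    have := inv_sub_inv_of_isotropic hN hC h h' c.2 (h1 c ((hcrit c).2 hc)).2
      (h2 c ((hcrit' c).2 hc)).2
    rw [this, sub_self]
  · exact ⟨2 / a' - 2 / a, fun c hc => inv_sub_inv_of_isotropic hN hC h h' c.2
      (h1 c ((hcrit c).2 hc)).2 (h2 c ((hcrit' c).2 hc)).2⟩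
  · refine ⟨0, fun c hc => ?_⟩
    obtain ⟨b, hb⟩ := h1 c ((hcrit c).2 hc)
    obtain ⟨b', hb'⟩ := h2 c ((hcrit' c).2 hc)
    rw [thickness_eq_of_eigenbasis hN hC h h' c.2 b b' (fun i => (hb i).1) (fun i => (hb' i).1),
      sub_self]
  · refine ⟨0, fun c hc => ?_⟩
    rw [thickness_eq_of_geomOperator_eq hN hC h h' c.2
      ((h1 c ((hcrit c).2 hc)).trans (h2 c ((hcrit' c).2 hc)).symm), sub_self]

/-! ### Comparison of two thickness functions with the same return map -/

lemma nonempty_frontier (hN : 2 ≤ N) (hC : IsConvexCore C) : (frontier C).Nonempty := by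
  have : Nontrivial (E N) := by
    obtain ⟨e, he, -⟩ := exists_orthogonal_ne_zero hN 0
    exact ⟨⟨e, 0, he⟩⟩
  exact nonempty_frontier_iff.2 ⟨hC.nonempty_interior.mono interior_subset, hC.isCompact.ne_univ⟩

/-- The elementary comparison behind the maximum principle. -/
lemma eq_zero_of_comparison {d d' q x y s s' : ℝ} (hd : 0 < d) (hlt : d < d') (hq : q ≤ 0)
    (hx : 0 ≤ x) (hy : y ≤ 0) (h : (d - q) * s = x - d * y) (h' : (d' - q) * s' = x - d' * y)
    (heq : s / d ^ 2 = s' / d' ^ 2) : x = 0 := by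
  have hd' : 0 < d' := hd.trans hlt
  have h1 : 0 < d - q := by linarith
  have h2 : 0 < d' - q := by linarith
  have e1 : s * d' ^ 2 = s' * d ^ 2 := by
    rwa [div_eq_div_iff (by positivity) (by positivity)] at heq
  have e2 : (x - d * y) * (d' - q) * d' ^ 2 = (x - d' * y) * (d - q) * d ^ 2 := by
    rw [← h, ← h']
    linear_combination (d - q) * (d' - q) * e1
  -- Eliminating s and s' leaves two nonnegative terms with sum zero; the coefficient of x is
  -- positive because d < d'.
  have e3 : x * ((d' - q) * d' ^ 2 - (d - q) * d ^ 2) +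
      (-y) * (d * d' * ((d' - q) * d' - (d - q) * d)) = 0 := by
    linear_combination e2
  have e4 : 0 < (d' - q) * d' ^ 2 - (d - q) * d ^ 2 := by
    have : (d - q) * d ^ 2 < (d' - q) * d' ^ 2 := by gcongr
    linarith
  have e5 : 0 < (d' - q) * d' - (d - q) * d := by
    have : (d - q) * d < (d' - q) * d' := by gcongr
    linarith
  have e6 : 0 ≤ (-y) * (d * d' * ((d' - q) * d' - (d - q) * d)) :=
    mul_nonneg (by linarith) (by positivity)
  have e7 : x * ((d' - q) * d' ^ 2 - (d - q) * d ^ 2) ≤ 0 := by linarith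
  nlinarith

lemma displacement_eq_zero_of_tangentialDeriv_eq (hC : IsConvexCore C) (h : IsReturnGeometry C Ω F)
    (h' : IsReturnGeometry C Ω' F) (c : frontier C)
    (hne : thickness C Ω c ≠ thickness C Ω' c)
    (heq : ∀ v, tangentialDeriv C (thickness C Ω) c v / thickness C Ω c ^ 2 =
      tangentialDeriv C (thickness C Ω') c v / thickness C Ω' c ^ 2) :
    tangentialDisplacement F c = 0 := by
  have e := h.mul_tangentialDeriv hC c (tangentialDisplacement F c)
  have e' := h'.mul_tangentialDeriv hC c (tangentialDisplacement F c)
  rw [inner_displacement, inner_displacement] at e e'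
  have hq := inner_normal_sub_nonpos hC c.2 (frontier_subset hC (F c).2)
  have hS := inner_shapeOperator_nonpos hC c.2 (tangentialDisplacement F c)
  have hx : 0 ≤ ⟪(tangentialDisplacement F c : E N), (tangentialDisplacement F c : E N)⟫ :=
    real_inner_self_nonneg
  have h0 : ⟪(tangentialDisplacement F c : E N), (tangentialDisplacement F c : E N)⟫ = 0 := by
    rcases lt_or_gt_of_ne hne with hlt | hlt
    · exact eq_zero_of_comparison (h.thickness_pos hC c.2) hlt hq hx hS e e' (heq _)
    · exact eq_zero_of_comparison (h'.thickness_pos hC c.2) hlt hq hx hS e' e (heq _).symm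
  exact_mod_cast inner_self_eq_zero.1 h0

/-- At an extremum of the difference of the reciprocals, the thicknesses agree or the return map
has no tangential displacement. -/
lemma displacement_eq_zero_of_isExtrOn (hC : IsConvexCore C) (h : IsReturnGeometry C Ω F)
    (h' : IsReturnGeometry C Ω' F) (c : frontier C)
    (hne : thickness C Ω c ≠ thickness C Ω' c)
    (hext : IsExtrOn (fun y => (thickness C Ω' y)⁻¹ - (thickness C Ω y)⁻¹) (frontier C) c) :
    tangentialDisplacement F c = 0 := by
  have hd := h.thickness_pos hC c.2
  have hd' := h'.thickness_pos hC c.2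
  have h1 := (h.differentiableOn_thickness c c.2).hasFDerivWithinAt
  have h2 := (h'.differentiableOn_thickness c c.2).hasFDerivWithinAt
  have i1 := (hasDerivAt_inv hd.ne').comp_hasFDerivWithinAt (c : E N) h1
  have i2 := (hasDerivAt_inv hd'.ne').comp_hasFDerivWithinAt (c : E N) h2
  refine displacement_eq_zero_of_tangentialDeriv_eq hC h h' c hne fun v => ?_
  have h4 : (-(thickness C Ω' c ^ 2)⁻¹ • fderivWithin ℝ (thickness C Ω') (frontier C) (c : E N) -
      -(thickness C Ω c ^ 2)⁻¹ • fderivWithin ℝ (thickness C Ω) (frontier C) (c : E N)) v = 0 := by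
    rcases hext with hmin | hmax
    · exact neg_eq_zero.1
        (tangentialDeriv_eq_zero_of_isMaxOn hC c.2 (i2.sub i1).neg hmin.neg v)
    · exact tangentialDeriv_eq_zero_of_isMaxOn hC c.2 (i2.sub i1) hmax v
  have e1 : fderivWithin ℝ (thickness C Ω) (frontier C) (c : E N) v =
    tangentialDeriv C (thickness C Ω) c v := rfl
  have e2 : fderivWithin ℝ (thickness C Ω') (frontier C) (c : E N) v =
    tangentialDeriv C (thickness C Ω') c v := rfl
  simp only [sub_apply, smul_apply, e1, e2, smul_eq_mul] at h4
  rw [div_eq_inv_mul, div_eq_inv_mul]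
  linarith

/-- Eliminating between the two first order equations makes D(d - d') proportional to d - d', with a
coefficient bounded on the compact boundary; Gronwall then applies. -/
lemma thickness_eq_of_eq_at (hN : 2 ≤ N) (hC : IsConvexCore C) (h : IsReturnGeometry C Ω F)
    (h' : IsReturnGeometry C Ω' F) {c₀ : E N} (hc₀ : c₀ ∈ frontier C)
    (h0 : thickness C Ω c₀ = thickness C Ω' c₀) (hc : c ∈ frontier C) :
    thickness C Ω c = thickness C Ω' c := by
  have hcpt := isCompact_frontier hC
  have hne := nonempty_frontier hN hC
  obtain ⟨c₁, hc₁, hmin⟩ := hcpt.exists_isMinOn hne h.differentiableOn_thickness.continuousOn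
  obtain ⟨c₂, hc₂, hmin'⟩ := hcpt.exists_isMinOn hne h'.differentiableOn_thickness.continuousOn
  obtain ⟨S, hS0, hS⟩ := exists_norm_shapeOperator_le hC
  obtain ⟨R, hR⟩ := hcpt.isBounded.exists_norm_le
  have hR0 : 0 ≤ R := (norm_nonneg _).trans (hR c₁ hc₁)
  set m := thickness C Ω c₁
  set m' := thickness C Ω' c₂
  have hm : 0 < m := h.thickness_pos hC hc₁
  have hm' : 0 < m' := h'.thickness_pos hC hc₂
  have hsub : DifferentiableOn ℝ (fun y => thickness C Ω y - thickness C Ω' y) (frontier C) :=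
    h.differentiableOn_thickness.sub h'.differentiableOn_thickness
  -- Here ‖z‖ and |q| are at most 2R, S bounds the shape operator, and d - q ≥ m, d' - q ≥ m' since
  -- q ≤ 0.
  have key := eq_zero_of_tangentialDeriv_le hN hC
    (f := fun y => thickness C Ω y - thickness C Ω' y)
    (K := (2 * R + 2 * R * (2 * R) * S) / (m * m')) (by positivity) hsub ?_ hc₀
    (sub_eq_zero.2 h0) hc
  · exact sub_eq_zero.1 key
  intro c hc v
  have hF : ∀ c : frontier C, ‖(F c : E N) - c‖ ≤ 2 * R := fun c =>
    (norm_sub_le _ _).trans (by linarith [hR _ (F c).2, hR _ c.2])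
  have e := h.mul_tangentialDeriv hC ⟨c, hc⟩ v
  have e' := h'.mul_tangentialDeriv hC ⟨c, hc⟩ v
  have hT : tangentialDeriv C (fun y => thickness C Ω y - thickness C Ω' y) c v =
      tangentialDeriv C (thickness C Ω) c v - tangentialDeriv C (thickness C Ω') c v :=
    tangentialDeriv_eq hC hc ((h.differentiableOn_thickness c hc).hasFDerivWithinAt.sub
      (h'.differentiableOn_thickness c hc).hasFDerivWithinAt) v
  have hz := hF ⟨c, hc⟩
  have hq := inner_normal_sub_nonpos hC hc (frontier_subset hC (F ⟨c, hc⟩).2)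
  have hmd : m ≤ thickness C Ω c := hmin hc
  have hmd' : m' ≤ thickness C Ω' c := hmin' hc
  rw [hT]
  simp only at e e' ⊢
  set z : E N := (F ⟨c, hc⟩ : E N) - c
  set q := ⟪normal C c, z⟫
  set d := thickness C Ω c
  set d' := thickness C Ω' c
  set s := tangentialDeriv C (thickness C Ω) c v
  set s' := tangentialDeriv C (thickness C Ω') c v
  have hqabs : |q| ≤ 2 * R := by
    refine (abs_real_inner_le_norm _ _).trans ?_
    rwa [norm_normal hC hc, one_mul]
  have hzv : |⟪z, (v : E N)⟫| ≤ 2 * R * ‖(v : E N)‖ := by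
    refine (abs_real_inner_le_norm _ _).trans ?_
    gcongr
  have hzS : |⟪z, (shapeOperator C c v : E N)⟫| ≤ 2 * R * (S * ‖(v : E N)‖) := by
    refine (abs_real_inner_le_norm _ _).trans ?_
    gcongr
    exact hS c hc v
  have e3 : (d - q) * (d' - q) * (s - s') =
      (d - d') * (q * ⟪z, (shapeOperator C c v : E N)⟫ - ⟪z, (v : E N)⟫) := by
    linear_combination (d' - q) * e - (d - q) * e'
  have hprod : m * m' ≤ (d - q) * (d' - q) := by
    gcongr <;> linarith
  have e4 : m * m' * |s - s'| ≤
      |d - d'| * ((2 * R + 2 * R * (2 * R) * S) * ‖(v : E N)‖) := by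
    calc m * m' * |s - s'| ≤ |(d - q) * (d' - q) * (s - s')| := by
          rw [abs_mul, abs_of_pos (lt_of_lt_of_le (by positivity) hprod)]
          gcongr
      _ = |d - d'| * |q * ⟪z, (shapeOperator C c v : E N)⟫ - ⟪z, (v : E N)⟫| := by
          rw [e3, abs_mul]
      _ ≤ |d - d'| * ((2 * R + 2 * R * (2 * R) * S) * ‖(v : E N)‖) := by
          gcongr
          refine (abs_sub _ _).trans ?_
          rw [abs_mul]
          have := mul_le_mul hqabs hzS (abs_nonneg _) (by positivity)
          linarith
  rw [div_mul_eq_mul_div, div_mul_eq_mul_div, le_div_iff₀ (by positivity)]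
  linarith

/-- Every point is critical, so d has zero differential; the Gronwall principle with K = 0 gives
constancy. -/
lemma thickness_eq_of_displacement_eq_zero (hN : 2 ≤ N) (hC : IsConvexCore C)
    (h : IsReturnGeometry C Ω F) (h0 : ∀ c, tangentialDisplacement F c = 0) {c₀ : E N}
    (hc₀ : c₀ ∈ frontier C) (hc : c ∈ frontier C) : thickness C Ω c = thickness C Ω c₀ := by
  have key := eq_zero_of_tangentialDeriv_le hN hC
    (f := fun y => thickness C Ω y - thickness C Ω c₀) le_rfl
    (h.differentiableOn_thickness.sub_const _) ?_ hc₀ (sub_self _) hc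
  · exact sub_eq_zero.1 key
  intro c hc v
  have hcrit : tangentialDeriv C (thickness C Ω) c = 0 := by
    simpa [tangentialGradient] using ((h.mem_criticalSet_iff hC ⟨c, hc⟩).2 (h0 _)).2
  have h1 : tangentialDeriv C (fun y => thickness C Ω y - thickness C Ω c₀) c v =
      tangentialDeriv C (thickness C Ω) c v :=
    tangentialDeriv_eq hC hc
      ((h.differentiableOn_thickness c hc).hasFDerivWithinAt.sub_const _) v
  simp [h1, hcrit]

lemma exists_thickness_eq_mul (hN : 2 ≤ N) (hC : IsConvexCore C) (h : IsReturnGeometry C Ω F)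
    (h' : IsReturnGeometry C Ω' F) (hA : SameConstraint C Ω Ω') :
    ∃ lam : ℝ, 0 < lam ∧ ∀ c ∈ frontier C, thickness C Ω' c = lam * thickness C Ω c := by
  by_cases hex : ∃ c₀ ∈ frontier C, thickness C Ω c₀ = thickness C Ω' c₀
  · obtain ⟨c₀, hc₀, h0⟩ := hex
    exact ⟨1, one_pos, fun c hc => by rw [one_mul, thickness_eq_of_eq_at hN hC h h' hc₀ h0 hc]⟩
  push Not at hex
  obtain ⟨k, hk⟩ := exists_inv_sub_inv_eq hN hC h h' hA
  set f : E N → ℝ := fun y => (thickness C Ω' y)⁻¹ - (thickness C Ω y)⁻¹ with hf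
  have hfc : ContinuousOn f (frontier C) :=
    (h'.differentiableOn_thickness.continuousOn.inv₀ fun y hy => (h'.thickness_pos hC hy).ne').sub
      (h.differentiableOn_thickness.continuousOn.inv₀ fun y hy => (h.thickness_pos hC hy).ne')
  have hfk : ∀ c ∈ frontier C, IsExtrOn f (frontier C) c → f c = k := fun c hc hext => by
    simpa [hf] using hk ⟨c, hc⟩
      (displacement_eq_zero_of_isExtrOn hC h h' ⟨c, hc⟩ (hex c hc) hext)
  obtain ⟨c₁, hc₁, hmin⟩ := (isCompact_frontier hC).exists_isMinOn (nonempty_frontier hN hC) hfc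
  obtain ⟨c₂, hc₂, hmax⟩ := (isCompact_frontier hC).exists_isMaxOn (nonempty_frontier hN hC) hfc
  -- The maximum and minimum of f are both k, so f is constant and every point is a maximum.
  have h0 : ∀ c : frontier C, tangentialDisplacement F c = 0 := fun c => by
    refine displacement_eq_zero_of_isExtrOn hC h h' c (hex c c.2) (Or.inr fun y hy => ?_)
    calc f y ≤ f c₂ := hmax hy
      _ = f c₁ := by rw [hfk c₂ hc₂ (Or.inr hmax), hfk c₁ hc₁ (Or.inl hmin)]
      _ ≤ f c := hmin c.2
  have hd := h.thickness_pos hC hc₁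
  refine ⟨thickness C Ω' c₁ / thickness C Ω c₁, div_pos (h'.thickness_pos hC hc₁) hd,
    fun c hc => ?_⟩
  rw [thickness_eq_of_displacement_eq_zero hN hC h h0 hc₁ hc,
    thickness_eq_of_displacement_eq_zero hN hC h' h0 hc₁ hc, div_mul_cancel₀ _ hd.ne']

/-- Domains with the same return map are dynamically equivalent. -/
lemma dynamicallyEquivalent_of_isReturnMap (h : IsReturnMap C Ω F) (h' : IsReturnMap C Ω' F) :
    DynamicallyEquivalent C Ω Ω' :=
  ⟨F, F, h, h', Homeomorph.refl _, rfl, fun _ => Set.image_id _,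
    fun _ m n hmn => ⟨m, n, hmn, rfl, rfl⟩⟩

end ReturnMap

end

theorem theorem8p3 {N : ℕ} (hN : 2 ≤ N) (C : Set (ReturnMap.E N))
    (hC : ReturnMap.IsConvexCore C)
    (F : frontier C → frontier C)
    (Ω Ω' : Set (ReturnMap.E N))
    (hΩ : ReturnMap.IsReturnGeometry C Ω F)
    (hΩ' : ReturnMap.IsReturnGeometry C Ω' F)
    (hA : ReturnMap.SameConstraint C Ω Ω') :
    (∃ lam : ℝ, 0 < lam ∧
      ∀ c ∈ frontier C, ReturnMap.thickness C Ω' c = lam * ReturnMap.thickness C Ω c) ∧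
    ReturnMap.DynamicallyEquivalent C Ω Ω' :=
  ⟨ReturnMap.exists_thickness_eq_mul hN hC hΩ hΩ' hA,
    ReturnMap.dynamicallyEquivalent_of_isReturnMap hΩ.isReturnMap hΩ'.isReturnMap⟩
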